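/- Let $X$ be a real Hausdorff locally convex topological vector space, let $X^*$ be its topological dual endowed with the weak* topology, let $T$ be a topological space, and let $f_t : X \to \mathbb{R}\cup\{\pm\infty\}$, $t \in T$, be convex functions (i.e. functions with convex epigraph $\{(z,r)\in X\times\mathbb{R} : f_t(z)\le r\}$). Put $f := \sup_{t\in T} f_t$ (pointwise), $\operatorname{dom} f := \{z \in X : f(z) < +\infty\}$ and, for $x\in X$ and $\varepsilon \ge 0$, $$T_\varepsilon(x) := \{t \in T : f_t(x) \ge f(x) - \varepsilon\}, \qquad T(x) := \{t \in T : f_t(x) = f(x)\}.$$ For $\varphi : X \to \mathbb{R}\cup\{\pm\infty\}$, let $\partial\varphi(x) := \{x^* \in X^* : \varphi(y) - \varphi(x) \ge \langle x^*, y - x\rangle \text{ for all } y \in X\}$ if $\varphi(x)\in\mathbb{R}$, and $\partial\varphi(x) := \emptyset$ otherwise. Let $x \in X$ be such that $f$ is finite and continuous at $x$, and suppose that for some $\varepsilon_0 > 0$: (i) the set $T_{\varepsilon_0}(x)$ is compact; (ii) for every $z \in \operatorname{dom} f$, the function $t \mapsto f_t(z)$ is upper semicontinuous on $T_{\varepsilon_0}(x)$.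 Then $$\partial f(x) = \operatorname{cl}\operatorname{co}\Big(\bigcup_{t\in T(x)} \partial f_t(x)\Big),$$ where $\operatorname{co}$ is the convex hull and $\operatorname{cl}$ the weak* closure. If moreover $X$ is finite-dimensional (i.e. $X = \mathbb{R}^n$), then $$\partial f(x) = \operatorname{co}\Big(\bigcup_{t\in T(x)} \partial f_t(x)\Big).$$ -/

import Mathlib

namespace SupSubdiff

/-- An extended-real-valued function is convex when its epigraph is a convex subset of `X × ℝ`.
This is the usual notion for functions with values in `[-∞, +∞]`; it is Jensen's inequality
under the convention `(+∞) + (-∞) = (-∞) + (+∞) = +∞`. -/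
def EConvex {X : Type*} [AddCommGroup X] [Module ℝ X] (φ : X → EReal) : Prop :=
  Convex ℝ {p : X × ℝ | φ p.1 ≤ (p.2 : EReal)}

/-- The effective domain of `φ`: the points where `φ < +∞`. -/
def edom {X : Type*} (φ : X → EReal) : Set X :=
  {z | φ z < ⊤}

/-- The pointwise supremum of a family of functions. -/
noncomputable def supFun {X T : Type*} (f : T → X → EReal) : X → EReal :=
  fun z => ⨆ t, f t z

/-- The `ε`-active index set at `x`: the indices with `f_t(x) ≥ f(x) - ε`, where `f = sup_t f_t`. -/
def epsActive {X T : Type*} (f : T → X → EReal) (ε : ℝ) (x : X) : Set T :=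
  {t | f t x ≥ supFun f x - (ε : EReal)}

/-- The active index set at `x`: the indices with `f_t(x) = f(x)`, where `f = sup_t f_t`. -/
def active {X T : Type*} (f : T → X → EReal) (x : X) : Set T :=
  {t | f t x = supFun f x}

/-- The Fenchel subdifferential of `φ` at `x`, as a subset of the topological dual with its
weak-* topology. It is empty when `φ x` is not finite. -/
def subdiff {X : Type*} [AddCommGroup X] [Module ℝ X] [TopologicalSpace X]
    (φ : X → EReal) (x : X) : Set (WeakDual ℝ X) :=
  {u | φ x ≠ ⊤ ∧ φ x ≠ ⊥ ∧ ∀ y : X, φ y - φ x ≥ ((u (y - x) : ℝ) : EReal)}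

end SupSubdiff

open Set Filter Topology

namespace SupSubdiff

/-! ### Convexity along rays. -/

section Algebraic

variable {X : Type*} [AddCommGroup X] [Module ℝ X]

/-! The inclusion `⊇` holds because the subdifferential of `f` is convex, weak* closed and contains
each active one. For `⊆`, a subgradient `u` of `f` outside the closed hull is separated from it by a
point `z`: `v z < a < u z` on the hull, so `f (x + s z) > F + s a` for `s > 0`, where `F = f x`. For
small `s`, the indices of `T_ε(x)` with `f_t (x + s z) ≥ F + s a` form a closed set
(semicontinuity), nonempty (functions starting below `F - ε` cannot catch up that fast) and
shrinking as `s` decreases (slopes are monotone). Compactness gives a common index, which is active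
(`exists_active_ray`); Hahn–Banach yields a subgradient of that `f_t` with slope at least `a` along
`z` (`exists_mem_subdiff_le`), a contradiction. In finite dimension the union is compact
(`isCompact_biUnion_subdiff`), hence so is its hull, by Carathéodory, and the closure is
superfluous. -/

theorem EConvex.combo_le {φ : X → EReal} (h : EConvex φ) {y z : X} {r q a : ℝ}
    (hy : φ y ≤ (r : EReal)) (hz : φ z ≤ (q : EReal)) (ha₀ : 0 ≤ a) (ha₁ : a ≤ 1) :
    φ ((1 - a) • y + a • z) ≤ (((1 - a) * r + a * q : ℝ) : EReal) := by
  have := h (x := (y, r)) hy (y := (z, q)) hz (sub_nonneg.2 ha₁) ha₀ (by ring)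
  simpa using this

theorem EConvex.ray_le {φ : X → EReal} (h : EConvex φ) {x z : X} {r q s d : ℝ}
    (hx : φ x ≤ (r : EReal)) (hd : φ (x + d • z) ≤ (q : EReal)) (hs : 0 ≤ s) (hsd : s ≤ d)
    (hd₀ : 0 < d) :
    φ (x + s • z) ≤ (((1 - s / d) * r + s / d * q : ℝ) : EReal) := by
  have := h.combo_le hx hd (div_nonneg hs hd₀.le) ((div_le_one hd₀).2 hsd)
  have e : (1 - s / d) • x + (s / d) • (x + d • z) = x + s • z := by
    have : s / d * d = s := by field_simp
    rw [smul_add, smul_smul, this]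
    module
  rwa [e] at this

/-- The slopes of a convex function along a ray, measured from a level above its initial value,
stay above `b` once they have reached it. -/
theorem EConvex.slope_mono {φ : X → EReal} (h : EConvex φ) {x z : X} {F b s d : ℝ}
    (hx : φ x ≤ (F : EReal)) (hs : 0 < s) (hsd : s ≤ d)
    (hsl : ((F + s * b : ℝ) : EReal) ≤ φ (x + s • z)) :
    ((F + d * b : ℝ) : EReal) ≤ φ (x + d • z) := by
  by_contra! hlt
  obtain ⟨q, hq₁, hq₂⟩ := EReal.lt_iff_exists_real_btwn.1 hlt
  have hd : 0 < d := hs.trans_le hsd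
  have h1 := hsl.trans (h.ray_le hx hq₁.le hs.le hsd hd)
  rw [EReal.coe_le_coe_iff] at h1
  rw [EReal.coe_lt_coe_iff] at hq₂
  have h2 : s / d * q < s / d * (F + d * b) := mul_lt_mul_of_pos_left hq₂ (div_pos hs hd)
  have h3 : s / d * (F + d * b) = s / d * F + s * b := by field_simp
  linarith

/-- A convex function starting strictly below the level `F` stays below the affine function
`s ↦ F + s * b` for a short time, uniformly over convex functions with given bounds. -/
theorem exists_forall_econvex_ray_lt (x z : X) {r F : ℝ} (hrF : r < F) (M b : ℝ) {d : ℝ}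
    (hd : 0 < d) :
    ∀ᶠ s in 𝓝[>] (0 : ℝ), ∀ φ : X → EReal, EConvex φ → φ x ≤ (r : EReal) →
      φ (x + d • z) ≤ (M : EReal) → φ (x + s • z) < ((F + s * b : ℝ) : EReal) := by
  have hc : Continuous fun s : ℝ => F + s * b - ((1 - s / d) * r + s / d * M) := by fun_prop
  have h1 : ∀ᶠ s in 𝓝[>] (0 : ℝ), 0 < F + s * b - ((1 - s / d) * r + s / d * M) :=
    (hc.continuousAt.eventually (lt_mem_nhds (by simpa using hrF))).filter_mono
      nhdsWithin_le_nhds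
  filter_upwards [h1, self_mem_nhdsWithin, Ioc_mem_nhdsGT hd] with s hs hs₀ hsd φ hφ hx hM
  refine (hφ.ray_le hx hM hs₀.le hsd.2 hd).trans_lt ?_
  rw [EReal.coe_lt_coe_iff]
  linarith

end Algebraic

/-! ### Subdifferentials and separation. -/

section Topological

variable {X : Type*} [AddCommGroup X] [Module ℝ X] [TopologicalSpace X]

theorem mem_subdiff_iff {φ : X → EReal} {x : X} {F : ℝ} (hF : φ x = F) {u : WeakDual ℝ X} :
    u ∈ subdiff φ x ↔ ∀ y, ((F + u (y - x) : ℝ) : EReal) ≤ φ y := by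
  have key : ∀ y, φ y - φ x ≥ ((u (y - x) : ℝ) : EReal) ↔
      ((F + u (y - x) : ℝ) : EReal) ≤ φ y := by
    intro y
    rw [hF]
    induction φ y with
    | bot =>
      rw [EReal.bot_sub, ge_iff_le, le_bot_iff, le_bot_iff]
      exact iff_of_false (EReal.coe_ne_bot _) (EReal.coe_ne_bot _)
    | top => simp
    | coe r =>
      rw [← EReal.coe_sub, ge_iff_le, EReal.coe_le_coe_iff, EReal.coe_le_coe_iff]
      constructor <;> intro h <;> linarith
  simp only [subdiff, mem_ofPred_eq, key]
  simp [hF]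

/-- Monotone slopes make a local subgradient global. Needed because semicontinuity in `t` is only
available at points of the domain of the supremum. -/
theorem mem_subdiff_of_eventually [IsTopologicalAddGroup X] [ContinuousSMul ℝ X]
    {φ : X → EReal} (h : EConvex φ) {x : X} {F : ℝ} (hF : φ x = F)
    {u : WeakDual ℝ X} (hu : ∀ᶠ y in 𝓝 x, ((F + u (y - x) : ℝ) : EReal) ≤ φ y) :
    u ∈ subdiff φ x := by
  rw [mem_subdiff_iff hF]
  intro y
  have hc : ContinuousAt (fun s : ℝ => x + s • (y - x)) 0 := by fun_prop
  have h1 : ∀ᶠ s in 𝓝[>] (0 : ℝ),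
      ((F + u (x + s • (y - x) - x) : ℝ) : EReal) ≤ φ (x + s • (y - x)) :=
    (hc.eventually (p := fun y => ((F + u (y - x) : ℝ) : EReal) ≤ φ y)
      (by
        beta_reduce
        rwa [zero_smul, add_zero])).filter_mono nhdsWithin_le_nhds
  obtain ⟨s, hs, hs₀⟩ := (h1.and (Ioc_mem_nhdsGT one_pos)).exists
  have := h.slope_mono (z := y - x) (d := 1) (b := u (y - x)) hF.le hs₀.1 hs₀.2
    (by simpa using hs)
  simpa using this

theorem convex_subdiff {φ : X → EReal} {x : X} {F : ℝ} (hF : φ x = F) :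
    Convex ℝ (subdiff φ x) := by
  intro u hu v hv a b ha hb hab
  rw [mem_subdiff_iff hF] at *
  intro y
  have h1 := hu y
  have h2 := hv y
  rcases le_total (u (y - x)) (v (y - x)) with h | h
  · refine le_trans ?_ h2
    rw [EReal.coe_le_coe_iff]
    change F + (a * u (y - x) + b * v (y - x)) ≤ _
    obtain rfl : b = 1 - a := by linarith
    nlinarith
  · refine le_trans ?_ h1
    rw [EReal.coe_le_coe_iff]
    change F + (a * u (y - x) + b * v (y - x)) ≤ _
    obtain rfl : b = 1 - a := by linarith
    nlinarith

theorem isClosed_subdiff {φ : X → EReal} {x : X} {F : ℝ} (hF : φ x = F) :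
    IsClosed (subdiff φ x) := by
  have : subdiff φ x = ⋂ y, {u | ((F + u (y - x) : ℝ) : EReal) ≤ φ y} := by
    ext u
    simp [mem_subdiff_iff hF]
  rw [this]
  refine isClosed_iInter fun y => isClosed_le ?_ continuous_const
  exact continuous_coe_real_ereal.comp (continuous_const.add (WeakDual.eval_continuous (y - x)))

/-- A convex function bounded above near `x` and dominating `F + s * b` along a ray issued from
`x` has a subgradient of slope at least `b` in the direction of the ray. -/
theorem exists_mem_subdiff_le [IsTopologicalAddGroup X] [ContinuousSMul ℝ X]
    {φ : X → EReal} (h : EConvex φ) {x z : X} {F M b : ℝ} (hF : φ x = F)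
    (hM : ∀ᶠ y in 𝓝 x, φ y ≤ (M : EReal))
    (hray : ∀ s : ℝ, 0 ≤ s → ((F + s * b : ℝ) : EReal) ≤ φ (x + s • z)) :
    ∃ v ∈ subdiff φ x, b ≤ v z := by
  let E : Set (X × ℝ) := {p | φ p.1 ≤ (p.2 : EReal)}
  let L : Set (X × ℝ) := (fun s : ℝ => (x + s • z, F + s * b)) '' Ici 0
  have hE : Convex ℝ E := h
  have hup : ∀ R, M < R → (x, R) ∈ interior E := by
    intro R hR
    rw [mem_interior_iff_mem_nhds, nhds_prod_eq]
    filter_upwards [prod_mem_prod hM (Ioi_mem_nhds hR)] with p hp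
    exact le_trans hp.1 (EReal.coe_le_coe_iff.2 (le_of_lt hp.2))
  have hL : Convex ℝ L := by
    rintro _ ⟨s, hs, rfl⟩ _ ⟨t, ht, rfl⟩ a c ha hc hac
    refine ⟨a * s + c * t, add_nonneg (mul_nonneg ha hs) (mul_nonneg hc ht), ?_⟩
    obtain rfl : c = 1 - a := by linarith
    ext
    · simp only [Prod.smul_mk, Prod.mk_add_mk]
      module
    · simp only [Prod.smul_mk, Prod.mk_add_mk, smul_eq_mul]
      ring
  -- An interior point of the epigraph can be lowered slightly within it, which `hray` forbids on
  -- the ray.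
  have hdisj : Disjoint (interior E) L := by
    rw [Set.disjoint_left]
    rintro _ hp ⟨s, hs, rfl⟩
    have hc : ContinuousAt (fun e : ℝ => (x + s • z, F + s * b - e)) 0 := by fun_prop
    have h1 : ∀ᶠ e in 𝓝[>] (0 : ℝ), (x + s • z, F + s * b - e) ∈ E :=
      (hc.eventually (by simpa using mem_interior_iff_mem_nhds.1 hp)).filter_mono
        nhdsWithin_le_nhds
    obtain ⟨e, he, he₀⟩ := (h1.and self_mem_nhdsWithin).exists
    have h2 := (hray s hs).trans he
    rw [EReal.coe_le_coe_iff] at h2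
    have : (0 : ℝ) < e := he₀
    simp only at h2
    linarith
  obtain ⟨g, k, hg₁, hg₂⟩ := geometric_hahn_banach_open hE.interior isOpen_interior hL hdisj
  have hsplit : ∀ y r, g (y, r) = g (y, 0) + r * g (0, 1) := by
    intro y r
    rw [← smul_eq_mul, ← map_smul, ← map_add]
    simp
  have hclos : ∀ (y : X) (r : ℝ), φ y ≤ (r : EReal) → g (y, r) ≤ k := by
    intro y r hy
    have h1 : (y, r) ∈ closure (interior E) := by
      rw [hE.closure_interior_eq_closure_of_nonempty_interior ⟨_, hup (M + 1) (by linarith)⟩]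
      exact subset_closure hy
    exact closure_minimal (fun p hp => (hg₁ p hp).le) (isClosed_le g.continuous continuous_const) h1
  have hk : ∀ s : ℝ, 0 ≤ s → k ≤ g (x + s • z, F + s * b) := fun s hs => hg₂ _ ⟨s, hs, rfl⟩
  -- The hyperplane is not vertical: a point high above `x` is interior to the epigraph, so `g` is
  -- `< k` there, yet `≥ k` at `(x, F)`.
  have hneg : g (0, 1) < 0 := by
    have h1 := hg₁ _ (hup (max M F + 1) (by linarith [le_max_left M F]))
    have h2 := hk 0 le_rfl
    simp only [zero_smul, add_zero, zero_mul] at h2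
    rw [hsplit] at h1 h2
    have h3 := le_max_right M F
    by_contra! hc
    have := mul_le_mul_of_nonneg_right (show F ≤ max M F + 1 by linarith) hc
    linarith
  set c : ℝ := -g (0, 1) with hc
  have hc₀ : 0 < c := by linarith
  let w : X →L[ℝ] ℝ := c⁻¹ • g.comp (ContinuousLinearMap.inl ℝ X ℝ)
  have hw : ∀ y, c * w y = g (y, 0) := by
    intro y
    change c * (c⁻¹ * g (y, 0)) = _
    field_simp
  have hgw : ∀ y r, g (y, r) = c * (w y - r) := by
    intro y r
    rw [hsplit, mul_sub, hw, hc]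
    ring
  refine ⟨StrongDual.toWeakDual w, (mem_subdiff_iff hF).2 fun y => ?_, ?_⟩
  · by_contra! hlt
    obtain ⟨r, hr₁, hr₂⟩ := EReal.lt_iff_exists_real_btwn.1 hlt
    rw [EReal.coe_lt_coe_iff] at hr₂
    change r < F + w (y - x) at hr₂
    rw [map_sub] at hr₂
    have h1 := hclos y r hr₁.le
    have h2 := hk 0 le_rfl
    simp only [zero_smul, add_zero, zero_mul] at h2
    have h3 := h1.trans h2
    rw [hgw, hgw, mul_le_mul_iff_right₀ hc₀] at h3
    linarith
  · change b ≤ w z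
    have h1 := hclos x F hF.le
    have h2 := hk 1 zero_le_one
    have h3 := h1.trans h2
    rw [hgw, hgw, mul_le_mul_iff_right₀ hc₀, map_add, one_smul] at h3
    linarith

/-- A weak-* separation theorem: the separating functional is evaluation at a point. -/
theorem exists_eval_separating {C : Set (WeakDual ℝ X)} (hC : Convex ℝ C) (hcl : IsClosed C)
    {u : WeakDual ℝ X} (hu : u ∉ C) : ∃ z : X, ∃ a : ℝ, a < u z ∧ ∀ v ∈ C, v z < a := by
  have : LocallyConvexSpace ℝ (WeakDual ℝ X) :=
    WeakBilin.locallyConvexSpace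
  obtain ⟨g, a, h₁, h₂⟩ := geometric_hahn_banach_closed_point hC hcl hu
  obtain ⟨z, hz⟩ := LinearMap.dualEmbedding_surjective (topDualPairing ℝ X) g
  subst hz
  exact ⟨z, a, h₂, h₁⟩

end Topological

/-! ### Carathéodory and compact hulls. -/

section CompactConvexHull

/-- In a finite-dimensional space, the convex hull of a compact set is compact. -/
theorem isCompact_convexHull_of_finiteDimensional {E : Type*} [AddCommGroup E] [Module ℝ E]
    [TopologicalSpace E] [IsTopologicalAddGroup E] [ContinuousSMul ℝ E] [FiniteDimensional ℝ E]
    {S : Set E} (hS : IsCompact S) : IsCompact (convexHull ℝ S) := by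
  let P : (n : ℕ) → (Fin n → ℝ) × (Fin n → E) → E := fun n p => ∑ i, p.1 i • p.2 i
  have hP : ∀ n, Continuous (P n) := fun n => by fun_prop
  have key : convexHull ℝ S = ⋃ n ∈ Finset.range (Module.finrank ℝ E + 2),
      P n '' (stdSimplex ℝ (Fin n) ×ˢ univ.pi fun _ => S) := by
    apply Subset.antisymm
    · intro y hy
      obtain ⟨ι, _, z, w, hzS, hz, hw₀, hw₁, hy⟩ := eq_pos_convex_span_of_mem_convexHull hy
      -- The points are affinely independent, so at most `dim + 1` of them occur; hence `range (dim
      -- + 2)`.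
      have hcard : Fintype.card ι ≤ Module.finrank ℝ E + 1 :=
        hz.card_le_finrank_succ.trans (Nat.succ_le_succ (Submodule.finrank_le _))
      let e := (Fintype.equivFin ι).symm
      refine mem_iUnion₂.2 ⟨Fintype.card ι, Finset.mem_range.2 (by omega),
        (w ∘ e, z ∘ e), ⟨⟨fun i => (hw₀ _).le, ?_⟩, fun i _ => hzS ⟨_, rfl⟩⟩, ?_⟩
      · rw [← hw₁]
        exact e.sum_comp w
      · rw [← hy]
        exact e.sum_comp fun i => w i • z i
    · refine iUnion₂_subset fun n _ => ?_
      rintro _ ⟨⟨w, z⟩, ⟨hw, hz⟩, rfl⟩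
      exact (convex_convexHull ℝ S).sum_mem (fun i _ => hw.1 i) hw.2
        fun i _ => subset_convexHull ℝ S (hz i trivial)
  rw [key]
  exact (Finset.range _).isCompact_biUnion fun n _ =>
    ((isCompact_stdSimplex ℝ (Fin n)).prod (isCompact_univ_pi fun _ => hS)).image (hP n)

end CompactConvexHull

/-! ### The supremum and its active indices. -/

section Supremum

theorem le_supFun {X T : Type*} (f : T → X → EReal) (t : T) (y : X) : f t y ≤ supFun f y :=
  le_iSup (fun t => f t y) t

theorem mem_epsActive_iff {X T : Type*} {f : T → X → EReal} {x : X} {F : ℝ} (hF : supFun f x = F)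
    {ε : ℝ} {t : T} : t ∈ epsActive f ε x ↔ ((F - ε : ℝ) : EReal) ≤ f t x := by
  rw [epsActive, mem_ofPred_eq, hF, EReal.coe_sub]

variable {X : Type*} [AddCommGroup X] [Module ℝ X] [TopologicalSpace X]
  {T : Type*}

theorem biUnion_subdiff_subset {f : T → X → EReal} {x : X} {F : ℝ} (hF : supFun f x = F) :
    ⋃ t ∈ active f x, subdiff (f t) x ⊆ subdiff (supFun f) x := by
  refine iUnion₂_subset fun t ht u hu => ?_
  rw [mem_subdiff_iff hF]
  intro y
  exact ((mem_subdiff_iff (Eq.trans ht hF)).1 hu y).trans (le_supFun f t y)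

variable [TopologicalSpace T]

/-- Along every direction some active index grows at least as fast as the supremum. -/
theorem exists_active_ray [IsTopologicalAddGroup X] [ContinuousSMul ℝ X]
    {f : T → X → EReal} (hconv : ∀ t, EConvex (f t)) {x : X} {F M : ℝ}
    (hF : supFun f x = F) (hM : ∀ᶠ y in 𝓝 x, supFun f y ≤ (M : EReal)) {ε : ℝ} (hε : 0 < ε)
    (hcomp : IsCompact (epsActive f ε x))
    (husc : ∀ z ∈ edom (supFun f), UpperSemicontinuousOn (fun t => f t z) (epsActive f ε x))
    {z : X} {b : ℝ} (hz : ∀ s : ℝ, 0 < s → ((F + s * b : ℝ) : EReal) < supFun f (x + s • z)) :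
    ∃ t ∈ active f x, ∀ s : ℝ, 0 ≤ s → ((F + s * b : ℝ) : EReal) ≤ f t (x + s • z) := by
  have hc : ContinuousAt (fun s : ℝ => x + s • z) 0 := by fun_prop
  have hMs : ∀ᶠ s in 𝓝[>] (0 : ℝ), supFun f (x + s • z) ≤ (M : EReal) :=
    (hc.eventually (by simpa using hM)).filter_mono nhdsWithin_le_nhds
  obtain ⟨d, hdM, hd⟩ := (hMs.and self_mem_nhdsWithin).exists
  replace hd : 0 < d := hd
  -- Any `f_t` starting at or below `F - ε` stays under `F + s * b` for small `s`, uniformly in `t`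
  -- thanks to the bound `M` at `x + d • z`.
  have hsmall := exists_forall_econvex_ray_lt x z (sub_lt_self F hε) M b hd
  obtain ⟨s₀, hs₀, hs₀'⟩ := mem_nhdsGT_iff_exists_Ioc_subset.1 (hMs.and hsmall)
  replace hs₀ : 0 < s₀ := hs₀
  have hx : ∀ t, f t x ≤ (F : EReal) := fun t => hF ▸ le_supFun f t x
  have : CompactSpace (epsActive f ε x) := isCompact_iff_compactSpace.1 hcomp
  let K : Ioc 0 s₀ → Set (epsActive f ε x) :=
    fun s => {t | ((F + s * b : ℝ) : EReal) ≤ f t (x + (s : ℝ) • z)}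
  have hKc : ∀ s, IsClosed (K s) := by
    intro s
    have h1 := husc (x + (s : ℝ) • z) (((hs₀' s.2).1).trans_lt (EReal.coe_lt_top M))
    exact upperSemicontinuous_iff_isClosed_preimage.1
      (upperSemicontinuousOn_iff_restrict.2 h1) _
  have hKn : ∀ s, (K s).Nonempty := by
    intro s
    obtain ⟨t, ht⟩ := lt_iSup_iff.1 (hz s s.2.1)
    have hta : t ∈ epsActive f ε x := by
      rw [mem_epsActive_iff hF]
      by_contra! hlt
      exact lt_asymm ht ((hs₀' s.2).2 (f t) (hconv t) hlt.le ((le_supFun f t _).trans hdM))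
    exact ⟨⟨t, hta⟩, ht.le⟩
  have hKm : Monotone K := fun s s' hss t ht =>
    (hconv t).slope_mono (hx t) s.2.1 hss ht
  have : Nonempty (Ioc 0 s₀) := ⟨⟨s₀, hs₀, le_rfl⟩⟩
  obtain ⟨⟨t, _⟩, htK⟩ := IsCompact.nonempty_iInter_of_directed_nonempty_isCompact_isClosed K
    hKm.directed_ge hKn (fun s => (hKc s).isCompact) hKc
  rw [mem_iInter] at htK
  -- Starting strictly below `F`, `f t` would lie under the line for small `s`, against `htK`.
  have htact : f t x = F := by
    refine le_antisymm (hx t) ?_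
    by_contra! hlt
    obtain ⟨r, hr₁, hr₂⟩ := EReal.lt_iff_exists_real_btwn.1 hlt
    have h1 := exists_forall_econvex_ray_lt x z (EReal.coe_lt_coe_iff.1 hr₂) M b hd
    obtain ⟨s, hs, hsI⟩ := (h1.and (Ioc_mem_nhdsGT hs₀)).exists
    exact absurd (htK ⟨s, hsI⟩)
      (not_le.2 (hs (f t) (hconv t) hr₁.le ((le_supFun f t _).trans hdM)))
  refine ⟨t, htact.trans hF.symm, fun s hs => ?_⟩
  rcases hs.eq_or_lt with rfl | hs
  · simp [htact]
  · rcases le_total s s₀ with h | h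
    · exact htK ⟨s, hs, h⟩
    · exact (hconv t).slope_mono (hx t) hs₀ h (htK ⟨s₀, hs₀, le_rfl⟩)

theorem subdiff_supFun_eq_closure [IsTopologicalAddGroup X] [ContinuousSMul ℝ X]
    {f : T → X → EReal} (hconv : ∀ t, EConvex (f t)) {x : X} {F M : ℝ}
    (hF : supFun f x = F) (hM : ∀ᶠ y in 𝓝 x, supFun f y ≤ (M : EReal)) {ε : ℝ} (hε : 0 < ε)
    (hcomp : IsCompact (epsActive f ε x))
    (husc : ∀ z ∈ edom (supFun f), UpperSemicontinuousOn (fun t => f t z) (epsActive f ε x)) :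
    subdiff (supFun f) x = closure (convexHull ℝ (⋃ t ∈ active f x, subdiff (f t) x)) := by
  apply Subset.antisymm
  · intro u hu
    by_contra hnot
    obtain ⟨z, a, hau, hC⟩ :=
      exists_eval_separating (convex_convexHull ℝ _).closure isClosed_closure hnot
    rw [mem_subdiff_iff hF] at hu
    obtain ⟨t, ht, hray⟩ := exists_active_ray hconv hF hM hε hcomp husc (z := z) (b := a) (by
      intro s hs
      refine lt_of_lt_of_le ?_ (hu (x + s • z))
      rw [EReal.coe_lt_coe_iff, add_sub_cancel_left, map_smul, smul_eq_mul]
      linarith [mul_lt_mul_of_pos_left hau hs])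
    obtain ⟨v, hv, hav⟩ := exists_mem_subdiff_le (hconv t) (Eq.trans ht hF)
      (hM.mono fun y hy => (le_supFun f t y).trans hy) hray
    exact (hC v (subset_closure (subset_convexHull ℝ _ (mem_iUnion₂.2 ⟨t, ht, hv⟩)))).not_ge hav
  · exact closure_minimal (convexHull_min (biUnion_subdiff_subset hF) (convex_subdiff hF))
      (isClosed_subdiff hF)

instance finiteDimensional_weakDual [FiniteDimensional ℝ X] :
    FiniteDimensional ℝ (WeakDual ℝ X) :=
  FiniteDimensional.of_injective
    (ContinuousLinearMap.coeLM ℝ : (X →L[ℝ] ℝ) →ₗ[ℝ] (X →ₗ[ℝ] ℝ))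
    ContinuousLinearMap.coe_injective

/-- Weak-* closed, pointwise bounded subsets of the dual of a finite-dimensional space are
compact. -/
theorem isCompact_of_isClosed_of_pointwise_bounded [FiniteDimensional ℝ X]
    {C : Set (WeakDual ℝ X)} (hcl : IsClosed C) (hb : ∀ z, ∃ R : ℝ, ∀ u ∈ C, u z ≤ R) :
    IsCompact C := by
  choose R hR using hb
  -- Basis coordinates embed the dual as a closed subspace of `ℝⁿ`; bounds at `±` basis vectors
  -- confine the image to a box.
  let e : WeakDual ℝ X →ₗ[ℝ] (Fin (Module.finrank ℝ X) → ℝ) :=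
    { toFun := fun u i => u (Module.finBasis ℝ X i)
      map_add' := fun _ _ => rfl
      map_smul' := fun _ _ => rfl }
  have hinj : Function.Injective e := by
    intro u v huv
    refine ContinuousLinearMap.coe_injective ((Module.finBasis ℝ X).ext fun i => ?_)
    exact congrFun huv i
  have hemb := LinearMap.isClosedEmbedding_of_injective (f := e) (LinearMap.ker_eq_bot.2 hinj)
  rw [hemb.isCompact_iff]
  refine IsCompact.of_isClosed_subset (isCompact_univ_pi fun i : Fin (Module.finrank ℝ X) =>
    isCompact_Icc (a := -R (-Module.finBasis ℝ X i)) (b := R (Module.finBasis ℝ X i)))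
    (hemb.isClosedMap _ hcl) ?_
  rintro _ ⟨u, hu, rfl⟩ i -
  have h := hR (-Module.finBasis ℝ X i) u hu
  rw [map_neg] at h
  exact ⟨neg_le.1 h, hR _ u hu⟩

theorem isCompact_subdiff [IsTopologicalAddGroup X] [ContinuousSMul ℝ X] [FiniteDimensional ℝ X]
    {φ : X → EReal} {x : X} {F M : ℝ} (hF : φ x = F)
    (hM : ∀ᶠ y in 𝓝 x, φ y ≤ (M : EReal)) : IsCompact (subdiff φ x) := by
  refine isCompact_of_isClosed_of_pointwise_bounded (isClosed_subdiff hF) fun z => ?_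
  have hc : ContinuousAt (fun s : ℝ => x + s • z) 0 := by fun_prop
  have hMs : ∀ᶠ s in 𝓝[>] (0 : ℝ), φ (x + s • z) ≤ (M : EReal) :=
    (hc.eventually (by simpa using hM)).filter_mono nhdsWithin_le_nhds
  obtain ⟨d, hdM, hd⟩ := (hMs.and self_mem_nhdsWithin).exists
  replace hd : 0 < d := hd
  refine ⟨(M - F) / d, fun u hu => ?_⟩
  have h := ((mem_subdiff_iff hF).1 hu (x + d • z)).trans hdM
  rw [EReal.coe_le_coe_iff, add_sub_cancel_left, map_smul, smul_eq_mul] at h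
  rw [le_div_iff₀ hd]
  linarith

/-- The union is the projection of a closed set of pairs (index, subgradient) inside the compact
product of `T_ε(x)` and the subdifferential of the supremum. -/
theorem isCompact_biUnion_subdiff [IsTopologicalAddGroup X] [ContinuousSMul ℝ X]
    [FiniteDimensional ℝ X]
    {f : T → X → EReal} (hconv : ∀ t, EConvex (f t)) {x : X} {F M : ℝ}
    (hF : supFun f x = F) (hM : ∀ᶠ y in 𝓝 x, supFun f y ≤ (M : EReal)) {ε : ℝ} (hε : 0 < ε)
    (hcomp : IsCompact (epsActive f ε x))
    (husc : ∀ z ∈ edom (supFun f), UpperSemicontinuousOn (fun t => f t z) (epsActive f ε x)) :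
    IsCompact (⋃ t ∈ active f x, subdiff (f t) x) := by
  have : CompactSpace (epsActive f ε x) := isCompact_iff_compactSpace.1 hcomp
  let G : Set (epsActive f ε x × WeakDual ℝ X) :=
    ⋂ y ∈ edom (supFun f), {p | ((F + p.2 (y - x) : ℝ) : EReal) ≤ f p.1 y}
  have hG : IsClosed G := by
    refine isClosed_biInter fun y hy => ?_
    have h1 := (upperSemicontinuousOn_iff_restrict.2 (husc y hy)).IsClosed_hypograph
    refine h1.preimage (f := fun p : epsActive f ε x × WeakDual ℝ X =>
      (p.1, ((F + p.2 (y - x) : ℝ) : EReal))) ?_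
    exact continuous_fst.prodMk (continuous_coe_real_ereal.comp
      (continuous_const.add ((WeakDual.eval_continuous (y - x)).comp continuous_snd)))
  have himg : ⋃ t ∈ active f x, subdiff (f t) x =
      Prod.snd '' (G ∩ univ ×ˢ subdiff (supFun f) x) := by
    apply Subset.antisymm
    · refine iUnion₂_subset fun t ht u hu => ?_
      have htF : f t x = F := Eq.trans ht hF
      have hta : t ∈ epsActive f ε x := by
        rw [mem_epsActive_iff hF, htF, EReal.coe_le_coe_iff]
        linarith
      refine ⟨(⟨t, hta⟩, u), ⟨mem_iInter₂.2 fun y _ => (mem_subdiff_iff htF).1 hu y, trivial,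
        biUnion_subdiff_subset hF (mem_iUnion₂.2 ⟨t, ht, hu⟩)⟩, rfl⟩
    · rintro _ ⟨⟨⟨t, _⟩, u⟩, ⟨hp, -⟩, rfl⟩
      have hp' := mem_iInter₂.1 hp
      have htF : f t x = F := by
        refine le_antisymm (hF ▸ le_supFun f t x) ?_
        -- The constraint at `y = x` alone forces the index to be active.
        simpa using hp' x (hF.trans_lt (EReal.coe_lt_top F))
      refine mem_iUnion₂.2 ⟨t, htF.trans hF.symm, mem_subdiff_of_eventually (hconv t) htF ?_⟩
      -- The domain of the supremum is a neighbourhood of `x`, so the constraints over it suffice.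
      filter_upwards [hM] with y hy
      exact hp' y (hy.trans_lt (EReal.coe_lt_top M))
  rw [himg]
  exact ((isCompact_univ.prod (isCompact_subdiff hF hM)).inter_left hG).image continuous_snd

end Supremum

end SupSubdiff

theorem mainTheorem8
    {X : Type*} [AddCommGroup X] [Module ℝ X] [TopologicalSpace X] [IsTopologicalAddGroup X]
    [ContinuousSMul ℝ X] [LocallyConvexSpace ℝ X] [T2Space X]
    {T : Type*} [TopologicalSpace T]
    (f : T → X → EReal) (hconv : ∀ t, SupSubdiff.EConvex (f t))
    (x : X)
    (hfin : SupSubdiff.supFun f x ≠ ⊤ ∧ SupSubdiff.supFun f x ≠ ⊥)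
    (hcont : ContinuousAt (SupSubdiff.supFun f) x)
    (ε₀ : ℝ) (hε₀ : 0 < ε₀)
    (hcomp : IsCompact (SupSubdiff.epsActive f ε₀ x))
    (husc : ∀ z ∈ SupSubdiff.edom (SupSubdiff.supFun f),
      UpperSemicontinuousOn (fun t => f t z) (SupSubdiff.epsActive f ε₀ x)) :
    SupSubdiff.subdiff (SupSubdiff.supFun f) x =
        closure (convexHull ℝ (⋃ t ∈ SupSubdiff.active f x, SupSubdiff.subdiff (f t) x)) ∧
      (FiniteDimensional ℝ X →
        SupSubdiff.subdiff (SupSubdiff.supFun f) x =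
          convexHull ℝ (⋃ t ∈ SupSubdiff.active f x, SupSubdiff.subdiff (f t) x)) := by
  lift SupSubdiff.supFun f x to ℝ using hfin with F hF
  have hF' := hF.symm
  have hM : ∀ᶠ y in nhds x, SupSubdiff.supFun f y ≤ ((F + 1 : ℝ) : EReal) :=
    (hcont.eventually (gt_mem_nhds (by
      rw [hF', EReal.coe_lt_coe_iff]
      exact lt_add_one F))).mono fun _ h => le_of_lt h
  have hcl := SupSubdiff.subdiff_supFun_eq_closure hconv hF' hM hε₀ hcomp husc
  refine ⟨hcl, fun _ => ?_⟩
  rw [hcl]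
  exact (SupSubdiff.isCompact_convexHull_of_finiteDimensional
    (SupSubdiff.isCompact_biUnion_subdiff hconv hF' hM hε₀ hcomp husc)).isClosed.closure_eq
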